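/- Let $X$ be a complex Banach space and let $T$ be a bounded linear operator on $X$; write $R(\cdot)$ and $N(\cdot)$ for range and null space. A bounded operator $S$ on $X$ is of topological uniform descent if there is $d\in\{0,1,2,\dots\}$ such that $R(S)+N(S^n)=R(S)+N(S^d)$ for all $n\ge d$ and $R(S)+N(S^d)$ is closed in $X$. It is Drazin invertible if it has finite ascent and finite descent, i.e. if $N(S^p)=N(S^{p+1})$ for some $p\ge 0$ and $R(S^q)=R(S^{q+1})$ for some $q\ge 0$. Let $\Gamma\subset\mathbb{C}$ be a nonempty connected set such that $T-\lambda I$ is of topological uniform descent for every $\lambda\in\Gamma$, and suppose that $T-\alpha I$ is Drazin invertible for some $\alpha\in\Gamma$. Then every point of $\sigma(T)\cap\Gamma$ is a pole of the resolvent of $T$ (that is, an isolated point of $\sigma(T)$ at which $\mu\mapsto(T-\mu I)^{-1}$ has a pole of finite positive order), and $\sigma(T)\cap\Gamma$ is a countable set that is discrete in its subspace topology. -/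

import Mathlib

open Topology Filter

namespace TUD

variable {X : Type*} [NormedAddCommGroup X] [NormedSpace ℂ X]

/-- `T` has uniform descent for `n ≥ d`: `R(T) + N(T ^ n) = R(T) + N(T ^ d)` for all `n ≥ d`. -/
def HasUniformDescent (T : X →L[ℂ] X) (d : ℕ) : Prop :=
  ∀ n : ℕ, d ≤ n →
    T.toLinearMap.range ⊔ (T ^ n).toLinearMap.ker =
      T.toLinearMap.range ⊔ (T ^ d).toLinearMap.ker

/-- `T` has topological uniform descent for `n ≥ d`: it has uniform descent for `n ≥ d` and
`R(T) + N(T ^ d)` is closed in `X`. -/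
def HasTopologicalUniformDescent (T : X →L[ℂ] X) (d : ℕ) : Prop :=
  HasUniformDescent T d ∧
    IsClosed ((T.toLinearMap.range ⊔ (T ^ d).toLinearMap.ker : Submodule ℂ X) : Set X)

/-- `T` is an operator of topological uniform descent. -/
def IsTopologicalUniformDescent (T : X →L[ℂ] X) : Prop :=
  ∃ d : ℕ, HasTopologicalUniformDescent T d

/-- The ascent of `T`: the infimum of the `n` with `N(T ^ n) = N(T ^ (n + 1))`
(`⊤` if there is none). -/
noncomputable def ascent (T : X →L[ℂ] X) : ℕ∞ :=
  ⨅ (n : ℕ) (_ : (T ^ n).toLinearMap.ker = (T ^ (n + 1)).toLinearMap.ker), (n : ℕ∞)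

/-- The descent of `T`: the infimum of the `n` with `R(T ^ n) = R(T ^ (n + 1))`
(`⊤` if there is none). -/
noncomputable def descent (T : X →L[ℂ] X) : ℕ∞ :=
  ⨅ (n : ℕ) (_ : (T ^ n).toLinearMap.range = (T ^ (n + 1)).toLinearMap.range), (n : ℕ∞)

/-- `T` is Drazin invertible: it has finite ascent and finite descent. -/
def IsDrazinInvertible (T : X →L[ℂ] X) : Prop :=
  ascent T < ⊤ ∧ descent T < ⊤

/-- `z` is a pole of the resolvent of `T`: `z` lies in the spectrum, a punctured neighbourhood
of `z` lies in the resolvent set (so that the values which Mathlib's `resolvent T` takes on the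
spectrum play no role), and there the resolvent is meromorphic at `z` with a pole, i.e. of
negative order. Mathlib's `resolvent T μ` is `(μ - T)⁻¹`; the sign does not affect poles. -/
def IsResolventPole (T : X →L[ℂ] X) (z : ℂ) : Prop :=
  z ∈ spectrum ℂ T ∧ (∀ᶠ μ in 𝓝[≠] z, μ ∈ resolventSet ℂ T) ∧
    MeromorphicAt (resolvent T : ℂ → X →L[ℂ] X) z ∧
    meromorphicOrderAt (resolvent T : ℂ → X →L[ℂ] X) z < 0

end TUD

/-! Let `S = T - z` with `z ∈ Γ`. Topological uniform descent makes the operator induced on `X ⧸ N(S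
^ d)` have closed range containing all its generalized kernels. If `z` is also in the closure of the
resolvent set, that operator is injective, then invertible (`injective_of_frequently_injective_sub`,
`isUnit_of_injective_of_frequently_isUnit_sub`). As `S ^ d` factors through the quotient, `S` has a
Drazin inverse (`exists_drazinInverse`), which yields a Laurent formula for the resolvent on a
punctured neighbourhood of `z` (`eventually_resolvent_eq`).

Hence the points with a punctured neighbourhood in the resolvent set form an open set whose trace on
`Γ` is relatively closed. It contains `α`, so connectedness gives all of `Γ`. -/

namespace TUD

/-! ### Closed-range operators that are limits of invertible ones. -/

section Semiregular

variable {Y : Type*} [NormedAddCommGroup Y] [NormedSpace ℂ Y] [CompleteSpace Y]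

/-- An operator with closed range whose range contains all the generalized kernels is injective,
provided that `0` is a limit of points `μ` for which `A - μ` is injective: a nonzero kernel vector
would extend to a holomorphic family of eigenvectors. -/
theorem injective_of_frequently_injective_sub (A : Y →L[ℂ] Y) (hA : IsClosed (Set.range A))
    (hker : ∀ n : ℕ, ∀ y : Y, (A ^ n) y = 0 → y ∈ Set.range A)
    (h : ∃ᶠ μ in 𝓝 (0 : ℂ), Function.Injective ⇑(A - μ • (1 : Y →L[ℂ] Y))) :
    Function.Injective A := by
  have hright : ∃ C > 0, ∀ y ∈ Set.range A, ∃ x, A x = y ∧ ‖x‖ ≤ C * ‖y‖ := by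
    have : CompleteSpace A.range := IsClosed.completeSpace_coe (hs := hA)
    obtain ⟨C, hC, H⟩ := (A.rangeRestrict).exists_preimage_norm_le
      (LinearMap.surjective_rangeRestrict A.toLinearMap)
    refine ⟨C, hC, fun y hy => ?_⟩
    obtain ⟨x, hx, hx'⟩ := H ⟨y, hy⟩
    exact ⟨x, congrArg Subtype.val hx, hx'⟩
  obtain ⟨C, hC, H⟩ := hright
  choose! g hg hgC using H
  rw [injective_iff_map_eq_zero]
  intro x hx
  -- Each iterate stays in a generalized kernel, hence in the range, so the (possibly nonlinear)
  -- right inverse `g` applies again.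
  have hpow : ∀ n : ℕ, (A ^ (n + 1)) (g^[n] x) = 0 := by
    intro n
    induction n with
    | zero => simpa using hx
    | succ n ih =>
      rw [Function.iterate_succ_apply', pow_succ, mul_apply_eq_comp,
        hg _ (hker _ _ ih), ih]
  have hnorm : ∀ n : ℕ, ‖g^[n] x‖ ≤ C ^ n * ‖x‖ := by
    intro n
    induction n with
    | zero => simp
    | succ n ih =>
      rw [Function.iterate_succ_apply', pow_succ']
      calc _ ≤ C * ‖g^[n] x‖ := hgC _ (hker _ _ (hpow n))
        _ ≤ C * (C ^ n * ‖x‖) := by gcongr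
        _ = _ := by ring
  -- Any ratio below `1 / 2` would do: the tail of the geometric series must be smaller than its
  -- first term.
  have hsmall : ∀ᶠ μ in 𝓝 (0 : ℂ), ‖μ‖ * C ≤ 1 / 3 := by
    have : Tendsto (fun μ : ℂ => ‖μ‖ * C) (𝓝 0) (𝓝 (‖(0 : ℂ)‖ * C)) := by
      apply Continuous.tendsto; fun_prop
    refine (this.eventually_lt_const (u := 1 / 3) (by simp)).mono fun μ hμ => hμ.le
  obtain ⟨μ, hinj, hμ⟩ := (h.and_eventually hsmall).exists
  have hterm : ∀ n : ℕ, ‖μ ^ n • g^[n] x‖ ≤ (1 / 3 : ℝ) ^ n * ‖x‖ := by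
    intro n
    rw [norm_smul, norm_pow]
    calc _ ≤ ‖μ‖ ^ n * (C ^ n * ‖x‖) := by gcongr; exact hnorm n
      _ = (‖μ‖ * C) ^ n * ‖x‖ := by ring
      _ ≤ _ := by gcongr
  have hgeom : HasSum (fun n : ℕ => (1 / 3 : ℝ) ^ n * ‖x‖) ((1 - 1 / 3)⁻¹ * ‖x‖) :=
    (hasSum_geometric_of_lt_one (by norm_num) (by norm_num)).mul_right _
  have hsum : Summable fun n : ℕ => μ ^ n • g^[n] x := .of_norm_bounded hgeom.summable hterm
  -- `A` kills the zeroth term and shifts the others down by one.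
  have heig : A (∑' n : ℕ, μ ^ n • g^[n] x) = μ • ∑' n : ℕ, μ ^ n • g^[n] x := by
    rw [A.map_tsum hsum, (A.summable hsum).tsum_eq_zero_add, ← tsum_const_smul'']
    have hx0 : A (μ ^ 0 • g^[0] x) = 0 := by simpa using hx
    rw [hx0, zero_add]
    refine tsum_congr fun n => ?_
    rw [map_smul, Function.iterate_succ_apply', hg _ (hker _ _ (hpow n)), pow_succ', mul_smul]
  have hzero : ∑' n : ℕ, μ ^ n • g^[n] x = 0 := by
    apply hinj
    simp [heig]
  have htail : ‖∑' n : ℕ, μ ^ (n + 1) • g^[n + 1] x‖ ≤ 1 / 3 * ((1 - 1 / 3)⁻¹ * ‖x‖) := by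
    refine tsum_of_norm_bounded (hgeom.mul_left (1 / 3)) fun n => ?_
    refine (hterm (n + 1)).trans_eq ?_
    ring
  rw [hsum.tsum_eq_zero_add, pow_zero, one_smul, Function.iterate_zero_apply,
    add_eq_zero_iff_eq_neg] at hzero
  rw [← norm_neg, ← hzero] at htail
  have : ‖x‖ = 0 := by
    have := norm_nonneg x
    norm_num at htail
    linarith
  simpa using this

/-- An injective operator with closed range is invertible if it is a limit of invertible operators
`A - μ`. -/
theorem isUnit_of_injective_of_frequently_isUnit_sub (A : Y →L[ℂ] Y)
    (hA : IsClosed (Set.range A)) (hinj : Function.Injective A)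
    (h : ∃ᶠ μ in 𝓝 (0 : ℂ), IsUnit (A - μ • (1 : Y →L[ℂ] Y))) : IsUnit A := by
  rcases subsingleton_or_nontrivial Y with hY | hY
  · exact isUnit_of_subsingleton A
  obtain ⟨K, hK⟩ := A.antilipschitz_of_injective_of_isClosed_range hinj hA
  have hbound : ∀ y : Y, ‖y‖ ≤ K * ‖A y‖ := fun y => by
    simpa using hK.le_mul_dist y 0
  have hsmall : ∀ᶠ μ in 𝓝 (0 : ℂ), ‖μ‖ * K < 1 / 3 := by
    have : Tendsto (fun μ : ℂ => ‖μ‖ * K) (𝓝 0) (𝓝 (‖(0 : ℂ)‖ * K)) := by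
      apply Continuous.tendsto; fun_prop
    exact this.eventually_lt_const (u := 1 / 3) (by simp)
  obtain ⟨μ, ⟨U, hU⟩, hμ⟩ := (h.and_eventually hsmall).exists
  have hinv : ∀ y : Y, A ((↑U⁻¹ : Y →L[ℂ] Y) y) = y + μ • (↑U⁻¹ : Y →L[ℂ] Y) y := fun y => by
    have h1 : (U : Y →L[ℂ] Y) ((↑U⁻¹ : Y →L[ℂ] Y) y) = y := by
      rw [← mul_apply_eq_comp, U.mul_inv, one_apply_eq_self]
    rw [hU] at h1
    simp only [sub_apply, smul_apply,
      one_apply_eq_self] at h1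
    exact sub_eq_iff_eq_add.1 h1
  -- The lower bound for `A` passes to `A - μ` with a loss of `(1 - 1 / 3)⁻¹ = 3 / 2`, so `A` lies
  -- within the radius of invertibility around `A - μ`.
  have hnorm : ‖(↑U⁻¹ : Y →L[ℂ] Y)‖ ≤ 3 / 2 * K := by
    refine ContinuousLinearMap.opNorm_le_bound _ (by positivity) fun y => ?_
    set w := (↑U⁻¹ : Y →L[ℂ] Y) y with hw
    have h1 := hbound w
    rw [hinv y, ← hw] at h1
    have h2 : ‖y + μ • w‖ ≤ ‖y‖ + ‖μ‖ * ‖w‖ := (norm_add_le _ _).trans_eq (by rw [norm_smul])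
    have h3 : ‖w‖ ≤ K * ‖y‖ + ‖μ‖ * K * ‖w‖ := by
      calc _ ≤ K * ‖y + μ • w‖ := h1
        _ ≤ K * (‖y‖ + ‖μ‖ * ‖w‖) := by gcongr
        _ = _ := by ring
    have h4 : ‖μ‖ * K * ‖w‖ ≤ 1 / 3 * ‖w‖ := by gcongr
    linarith
  have hpos : 0 < ‖(↑U⁻¹ : Y →L[ℂ] Y)‖ := Units.norm_pos _
  refine ⟨U.ofNearby A ?_, rfl⟩
  rw [hU, sub_sub_cancel, norm_smul, norm_one, mul_one, ← one_div, lt_div_iff₀ hpos]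
  calc ‖μ‖ * ‖(↑U⁻¹ : Y →L[ℂ] Y)‖ ≤ ‖μ‖ * (3 / 2 * K) := by gcongr
    _ < 1 := by linarith

end Semiregular
variable {X : Type*} [NormedAddCommGroup X] [NormedSpace ℂ X]

/-! ### The induced operator on `X ⧸ N(S ^ d)`. -/

instance isClosed_ker_pow (S : X →L[ℂ] X) (d : ℕ) :
    IsClosed ((S ^ d).toLinearMap.ker : Set X) :=
  (S ^ d).isClosed_ker

/-- The operator induced by `S` on `X ⧸ N(S ^ d)`. -/
noncomputable def quotientKerPow (S : X →L[ℂ] X) (d : ℕ) :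
    (X ⧸ (S ^ d).toLinearMap.ker) →L[ℂ] (X ⧸ (S ^ d).toLinearMap.ker) :=
  (S ^ d).toLinearMap.ker.liftQL ((S ^ d).toLinearMap.ker.mkQL ∘L S) fun x hx => by
    have hx' : (S ^ d) x = 0 := hx
    have : (S ^ d) (S x) = 0 := by
      rw [← mul_apply_eq_comp, ← pow_succ, pow_succ', mul_apply_eq_comp, hx', map_zero]
    exact (Submodule.Quotient.mk_eq_zero _).2 this

theorem quotientKerPow_mk (S : X →L[ℂ] X) (d : ℕ) (x : X) :
    quotientKerPow S d (Submodule.Quotient.mk x) = Submodule.Quotient.mk (S x) := rfl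

theorem quotientKerPow_pow_mk (S : X →L[ℂ] X) (d n : ℕ) (x : X) :
    (quotientKerPow S d ^ n) (Submodule.Quotient.mk x) = Submodule.Quotient.mk ((S ^ n) x) := by
  induction n with
  | zero => rfl
  | succ n ih => rw [pow_succ', mul_apply_eq_comp, ih, quotientKerPow_mk, pow_succ',
      mul_apply_eq_comp]

theorem mk_ker_pow_eq_zero_iff (S : X →L[ℂ] X) (d : ℕ) (x : X) :
    (Submodule.Quotient.mk x : X ⧸ (S ^ d).toLinearMap.ker) = 0 ↔ (S ^ d) x = 0 :=
  Submodule.Quotient.mk_eq_zero _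

theorem mk_mem_range_quotientKerPow_iff (S : X →L[ℂ] X) (d : ℕ) (x : X) :
    (Submodule.Quotient.mk x : X ⧸ (S ^ d).toLinearMap.ker) ∈ Set.range (quotientKerPow S d) ↔
      x ∈ S.toLinearMap.range ⊔ (S ^ d).toLinearMap.ker := by
  rw [Submodule.mem_sup]
  constructor
  · rintro ⟨y, hy⟩
    obtain ⟨y, rfl⟩ := Submodule.Quotient.mk_surjective _ y
    rw [quotientKerPow_mk, Submodule.Quotient.eq] at hy
    exact ⟨S y, ⟨y, rfl⟩, x - S y, by simpa using neg_mem hy, by abel⟩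
  · rintro ⟨_, ⟨y, rfl⟩, z, hz, rfl⟩
    refine ⟨Submodule.Quotient.mk y, ?_⟩
    rw [quotientKerPow_mk, Submodule.Quotient.eq]
    simpa using hz

theorem pow_apply_pow_apply (S : X →L[ℂ] X) (m n : ℕ) (x : X) :
    (S ^ m) ((S ^ n) x) = (S ^ (m + n)) x := by
  rw [pow_add, mul_apply_eq_comp]

/-- The preimage in `X` of the `n`-th kernel is `N(S ^ (d + n))`, and that of the range is `R(S) +
N(S ^ d)`, which uniform descent equates with `R(S) + N(S ^ (d + n))`. -/
theorem ker_pow_le_range_quotientKerPow {S : X →L[ℂ] X} {d : ℕ} (hS : HasUniformDescent S d)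
    (n : ℕ) (y : X ⧸ (S ^ d).toLinearMap.ker) (hy : (quotientKerPow S d ^ n) y = 0) :
    y ∈ Set.range (quotientKerPow S d) := by
  obtain ⟨x, rfl⟩ := Submodule.Quotient.mk_surjective _ y
  rw [quotientKerPow_pow_mk, mk_ker_pow_eq_zero_iff, pow_apply_pow_apply] at hy
  rw [mk_mem_range_quotientKerPow_iff, ← hS (d + n) (by omega)]
  exact Submodule.mem_sup_right hy

theorem isClosed_range_quotientKerPow {S : X →L[ℂ] X} {d : ℕ}
    (hS : IsClosed ((S.toLinearMap.range ⊔ (S ^ d).toLinearMap.ker : Submodule ℂ X) : Set X)) :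
    IsClosed (Set.range (quotientKerPow S d)) := by
  rw [← (S ^ d).toLinearMap.ker.isQuotientMap_mkQL.isClosed_preimage]
  convert hS using 1
  ext x
  exact mk_mem_range_quotientKerPow_iff S d x

theorem quotientKerPow_sub_smul_mk (S : X →L[ℂ] X) (d : ℕ) (μ : ℂ) (x : X) :
    (quotientKerPow S d - μ • (1 : (X ⧸ (S ^ d).toLinearMap.ker) →L[ℂ]
      (X ⧸ (S ^ d).toLinearMap.ker))) (Submodule.Quotient.mk x) =
      Submodule.Quotient.mk ((S - μ • (1 : X →L[ℂ] X)) x) := rfl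

theorem ker_pow_eq_of_le {S : X →L[ℂ] X} {p : ℕ}
    (hp : (S ^ p).toLinearMap.ker = (S ^ (p + 1)).toLinearMap.ker) {n : ℕ} (hn : p ≤ n) {x : X}
    (hx : (S ^ n) x = 0) : (S ^ p) x = 0 := by
  induction n, hn using Nat.le_induction generalizing x with
  | base => exact hx
  | succ n hn ih =>
    have h1 : (S ^ p) (S x) = 0 := ih (by rw [← mul_apply_eq_comp, ← pow_succ, hx])
    have h2 : x ∈ (S ^ (p + 1)).toLinearMap.ker := by
      rw [LinearMap.mem_ker]
      change (S ^ (p + 1)) x = 0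
      rw [pow_succ, mul_apply_eq_comp, h1]
    rw [← hp] at h2
    exact h2

theorem exists_pow_eq_of_le {S : X →L[ℂ] X} {q : ℕ}
    (hq : (S ^ q).toLinearMap.range = (S ^ (q + 1)).toLinearMap.range) {n : ℕ} (hn : q ≤ n)
    (x : X) : ∃ y, (S ^ (n + 1)) y = (S ^ n) x := by
  have h1 : (S ^ q) x ∈ (S ^ (q + 1)).toLinearMap.range := hq ▸ ⟨x, rfl⟩
  obtain ⟨y, hy⟩ := h1
  have hy : (S ^ (q + 1)) y = (S ^ q) x := hy
  obtain ⟨k, rfl⟩ := Nat.exists_eq_add_of_le' hn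
  exact ⟨y, by rw [add_assoc, ← pow_apply_pow_apply, hy, pow_apply_pow_apply]⟩

variable [CompleteSpace X]

theorem isUnit_quotientKerPow_sub {S : X →L[ℂ] X} {μ : ℂ}
    (h : IsUnit (S - μ • (1 : X →L[ℂ] X))) (d : ℕ) :
    IsUnit (quotientKerPow S d - μ • (1 : (X ⧸ (S ^ d).toLinearMap.ker) →L[ℂ]
      (X ⧸ (S ^ d).toLinearMap.ker))) := by
  rw [ContinuousLinearMap.isUnit_iff_bijective] at h ⊢
  constructor
  · rw [injective_iff_map_eq_zero]
    intro y hy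
    obtain ⟨x, rfl⟩ := Submodule.Quotient.mk_surjective _ y
    rw [quotientKerPow_sub_smul_mk, mk_ker_pow_eq_zero_iff] at hy
    rw [mk_ker_pow_eq_zero_iff]
    apply (injective_iff_map_eq_zero _).1 h.1
    have hcomm : Commute (S - μ • (1 : X →L[ℂ] X)) (S ^ d) :=
      ((Commute.refl S).pow_right d).sub_left ((Commute.one_left _).smul_left μ)
    rw [← mul_apply_eq_comp, hcomm.eq, mul_apply_eq_comp, hy]
  · intro y
    obtain ⟨x, rfl⟩ := Submodule.Quotient.mk_surjective _ y
    obtain ⟨z, rfl⟩ := h.2 x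
    exact ⟨Submodule.Quotient.mk z, quotientKerPow_sub_smul_mk S d μ z⟩

/-- An operator of topological uniform descent which is a limit of invertible operators `S - μ`
induces an invertible operator on some `X ⧸ N(S ^ d)`. -/
theorem IsTopologicalUniformDescent.exists_isUnit_quotientKerPow {S : X →L[ℂ] X}
    (hS : IsTopologicalUniformDescent S)
    (h : ∃ᶠ μ in 𝓝 (0 : ℂ), IsUnit (S - μ • (1 : X →L[ℂ] X))) :
    ∃ d, IsUnit (quotientKerPow S d) := by
  obtain ⟨d, hd, hcl⟩ := hS
  have h' := h.mono fun μ hμ => isUnit_quotientKerPow_sub hμ d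
  have hcl' := isClosed_range_quotientKerPow hcl
  refine ⟨d, isUnit_of_injective_of_frequently_isUnit_sub _ hcl' ?_ h'⟩
  refine injective_of_frequently_injective_sub _ hcl' (ker_pow_le_range_quotientKerPow hd) ?_
  exact h'.mono fun μ hμ => (ContinuousLinearMap.isUnit_iff_bijective.1 hμ).1

/-- A Drazin invertible operator induces an invertible operator on some `X ⧸ N(S ^ d)`. -/
theorem IsDrazinInvertible.exists_isUnit_quotientKerPow {S : X →L[ℂ] X}
    (hS : IsDrazinInvertible S) : ∃ d, IsUnit (quotientKerPow S d) := by
  obtain ⟨ha, hd⟩ := hS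
  simp only [ascent, descent, iInf_lt_iff] at ha hd
  obtain ⟨p, hp, -⟩ := ha
  obtain ⟨q, hq, -⟩ := hd
  refine ⟨max p q, ContinuousLinearMap.isUnit_iff_bijective.2 ⟨?_, fun y => ?_⟩⟩
  · rw [injective_iff_map_eq_zero]
    intro y hy
    obtain ⟨x, rfl⟩ := Submodule.Quotient.mk_surjective _ y
    rw [quotientKerPow_mk, mk_ker_pow_eq_zero_iff, ← mul_apply_eq_comp, ← pow_succ] at hy
    have hx := ker_pow_eq_of_le hp (by omega) hy
    obtain ⟨k, hk⟩ := Nat.exists_eq_add_of_le' (le_max_left p q)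
    rw [mk_ker_pow_eq_zero_iff, hk, ← pow_apply_pow_apply, hx, map_zero]
  · obtain ⟨x, rfl⟩ := Submodule.Quotient.mk_surjective _ y
    obtain ⟨y, hy⟩ := exists_pow_eq_of_le hq (le_max_right p q) x
    refine ⟨Submodule.Quotient.mk y, ?_⟩
    rw [quotientKerPow_mk, ← sub_eq_zero, ← Submodule.Quotient.mk_sub, mk_ker_pow_eq_zero_iff,
      map_sub, ← mul_apply_eq_comp, ← pow_succ, hy, sub_self]

/-! ### Drazin inverses and the Laurent form of the resolvent. -/

omit [CompleteSpace X] in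
/-- If `S ^ d` factors through a space on which `S` acts invertibly, then `S` has a Drazin
inverse. -/
theorem exists_drazinInverse_of_factorization {Q : Type*} [NormedAddCommGroup Q]
    [NormedSpace ℂ Q] {S : X →L[ℂ] X} {d : ℕ} (π : X →L[ℂ] Q) (ι : Q →L[ℂ] X)
    (U : (Q →L[ℂ] Q)ˣ) (hιU : ∀ y, S (ι y) = ι ((U : Q →L[ℂ] Q) y))
    (hUπ : ∀ x, π (S x) = (U : Q →L[ℂ] Q) (π x))
    (hπι : ∀ y, π (ι y) = ((U ^ d : (Q →L[ℂ] Q)ˣ) : Q →L[ℂ] Q) y)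
    (hιπ : ∀ x, ι (π x) = (S ^ d) x) :
    ∃ D : X →L[ℂ] X, S * D = D * S ∧ S * D * D = D ∧ S ^ d * (S * D) = S ^ d := by
  have hmul : ∀ (V W : (Q →L[ℂ] Q)ˣ) (y : Q), (V : Q →L[ℂ] Q) ((W : Q →L[ℂ] Q) y) =
      ((V * W : (Q →L[ℂ] Q)ˣ) : Q →L[ℂ] Q) y := fun _ _ _ => rfl
  -- The exponent makes `S * D = ι U⁻ᵈ π`, which is idempotent because `π ι = Uᵈ`.
  let D : X →L[ℂ] X := ι ∘L (((U ^ (d + 1))⁻¹ : (Q →L[ℂ] Q)ˣ) : Q →L[ℂ] Q) ∘L π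
  have hD : ∀ x, D x = ι ((((U ^ (d + 1))⁻¹ : (Q →L[ℂ] Q)ˣ) : Q →L[ℂ] Q) (π x)) := fun _ => rfl
  have hSD : ∀ x, S (D x) = ι ((((U ^ d)⁻¹ : (Q →L[ℂ] Q)ˣ) : Q →L[ℂ] Q) (π x)) := fun x => by
    rw [hD, hιU, hmul, pow_succ, mul_inv_rev, mul_inv_cancel_left]
  refine ⟨D, ?_, ?_, ?_⟩ <;> ext x <;> simp only [mul_apply_eq_comp]
  · rw [hSD, hD, hUπ, hmul, pow_succ', mul_inv_rev, inv_mul_cancel_right]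
  · rw [hSD, hD, hπι, hmul, hmul, inv_mul_cancel, one_mul]
  · rw [hSD, ← hιπ, hπι, hmul, mul_inv_cancel, Units.val_one, one_apply_eq_self, hιπ]

omit [CompleteSpace X] in
/-- If `S` induces an invertible operator on `X ⧸ N(S ^ d)`, then it has a Drazin inverse. -/
theorem exists_drazinInverse {S : X →L[ℂ] X} {d : ℕ} (h : IsUnit (quotientKerPow S d)) :
    ∃ D : X →L[ℂ] X, S * D = D * S ∧ S * D * D = D ∧ S ^ d * (S * D) = S ^ d := by
  obtain ⟨U, hU⟩ := h
  refine exists_drazinInverse_of_factorization (S ^ d).toLinearMap.ker.mkQL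
    ((S ^ d).toLinearMap.ker.liftQL (S ^ d) le_rfl) U (fun y => ?_) (fun x => ?_) (fun y => ?_)
    (fun x => rfl)
  · obtain ⟨x, rfl⟩ := Submodule.Quotient.mk_surjective _ y
    rw [hU, quotientKerPow_mk]
    change S ((S ^ d) x) = (S ^ d) (S x)
    rw [← mul_apply_eq_comp, ← pow_succ', pow_succ, mul_apply_eq_comp]
  · rw [hU]; rfl
  · obtain ⟨x, rfl⟩ := Submodule.Quotient.mk_surjective _ y
    rw [Units.val_pow_eq_pow_val, hU, quotientKerPow_pow_mk]
    rfl

/-- The idempotent `S * D` splits the problem: `S ^ d` vanishes on the `1 - S * D` part, so a finite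
geometric sum inverts `w - S` there; on the other part `D` inverts `S` and `(w - S) * D = -(S * D) *
(1 - w • D)`. -/
theorem mul_drazinResolvent {A : Type*} [Ring A] [Algebra ℂ A] {S D E : A} {d : ℕ} {w : ℂ}
    (hw : w ≠ 0) (hDD : S * D * D = D) (hd : S ^ d * (S * D) = S ^ d)
    (hE : (1 - w • D) * E = 1) :
    (algebraMap ℂ A w - S) *
      ((∑ k ∈ Finset.range d, (w⁻¹) ^ (k + 1) • S ^ k) * (1 - S * D) - D * E) = 1 := by
  have hsum : (algebraMap ℂ A w - S) * ∑ k ∈ Finset.range d, (w⁻¹) ^ (k + 1) • S ^ k =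
      1 - (w⁻¹) ^ d • S ^ d := by
    clear hd
    induction d with
    | zero => simp
    | succ d ih =>
      rw [Finset.sum_range_succ, mul_add, ih, sub_mul, ← Algebra.smul_def, smul_smul,
        mul_smul_comm, ← pow_succ', pow_succ' w⁻¹ d, mul_inv_cancel_left₀ hw]
      abel
  have hD : (algebraMap ℂ A w - S) * D = -(S * D * (1 - w • D)) := by
    rw [mul_sub, mul_one, mul_smul_comm, hDD, sub_mul, ← Algebra.smul_def]
    abel
  rw [mul_sub, ← mul_assoc, hsum, ← mul_assoc, hD, neg_mul, mul_assoc (S * D), hE, sub_mul,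
    smul_mul_assoc, mul_sub (S ^ d), hd]
  simp

theorem drazinResolvent_mul {A : Type*} [Ring A] [Algebra ℂ A] {S D E : A} {d : ℕ} {w : ℂ}
    (hw : w ≠ 0) (hSD : S * D = D * S) (hDD : S * D * D = D) (hd : S ^ d * (S * D) = S ^ d)
    (hE : (1 - w • D) * E = 1) (hE' : E * (1 - w • D) = 1) :
    ((∑ k ∈ Finset.range d, (w⁻¹) ^ (k + 1) • S ^ k) * (1 - S * D) - D * E) *
      (algebraMap ℂ A w - S) = 1 := by
  have hcS : Commute S D := hSD
  have hcw : ∀ a : A, Commute (algebraMap ℂ A w) a := Algebra.commutes w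
  have hcE : Commute S E := by
    have h1 : Commute S (1 - w • D) := (Commute.one_right S).sub_right (hcS.smul_right w)
    exact Commute.units_inv_right (u := Units.mk _ _ hE hE') h1
  have hc : Commute (algebraMap ℂ A w - S)
      ((∑ k ∈ Finset.range d, (w⁻¹) ^ (k + 1) • S ^ k) * (1 - S * D) - D * E) := by
    refine (hcw _).sub_left (Commute.sub_right (Commute.mul_right ?_ ?_) (hcS.mul_right hcE))
    · exact Commute.sum_right _ _ _ fun k _ => ((Commute.refl S).pow_right k).smul_right _
    · exact (Commute.one_right S).sub_right ((Commute.refl S).mul_right hcS)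
  rw [← hc.eq, mul_drazinResolvent hw hDD hd hE]

/-- Near a point where `T - z` has a Drazin inverse, the resolvent of `T` is given by a finite
Laurent principal part and a Neumann series. -/
theorem eventually_resolvent_eq {T D : X →L[ℂ] X} {z : ℂ} {d : ℕ}
    (hSD : (T - z • 1) * D = D * (T - z • 1)) (hDD : (T - z • 1) * D * D = D)
    (hd : (T - z • 1) ^ d * ((T - z • 1) * D) = (T - z • 1) ^ d) :
    ∀ᶠ μ in 𝓝[≠] z, μ ∈ resolventSet ℂ T ∧ resolvent T μ =
      (∑ k ∈ Finset.range d, ((μ - z)⁻¹) ^ (k + 1) • (T - z • 1) ^ k) * (1 - (T - z • 1) * D) -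
        D * Ring.inverse (1 - (μ - z) • D) := by
  have hnear : ∀ᶠ μ in 𝓝 z, IsUnit (1 - (μ - z) • D) := by
    have hc : Continuous fun μ : ℂ => 1 - (μ - z) • D := by fun_prop
    exact (Units.isOpen.preimage hc).mem_nhds (by simp)
  filter_upwards [hnear.filter_mono nhdsWithin_le_nhds, self_mem_nhdsWithin] with μ hμ hne
  have hw : μ - z ≠ 0 := sub_ne_zero.2 hne
  have hE := Ring.mul_inverse_cancel _ hμ
  have hE' := Ring.inverse_mul_cancel _ hμ
  have h1 := mul_drazinResolvent hw hDD hd hE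
  have h2 := drazinResolvent_mul hw hSD hDD hd hE hE'
  have hsub : algebraMap ℂ (X →L[ℂ] X) (μ - z) - (T - z • 1) = algebraMap ℂ _ μ - T := by
    rw [map_sub, Algebra.algebraMap_eq_smul_one z]
    abel
  rw [hsub] at h1 h2
  refine ⟨⟨Units.mk _ _ h1 h2, rfl⟩, ?_⟩
  exact Ring.inverse_unit (Units.mk _ _ h1 h2)

theorem eventually_mem_resolventSet {T : X →L[ℂ] X} {z : ℂ}
    (h : ∃ d, IsUnit (quotientKerPow (T - z • (1 : X →L[ℂ] X)) d)) :
    ∀ᶠ μ in 𝓝[≠] z, μ ∈ resolventSet ℂ T := by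
  obtain ⟨d, hd⟩ := h
  obtain ⟨D, hSD, hDD, hd⟩ := exists_drazinInverse hd
  exact (eventually_resolvent_eq hSD hDD hd).mono fun μ hμ => hμ.1

theorem meromorphicAt_resolvent {T : X →L[ℂ] X} {z : ℂ}
    (h : ∃ d, IsUnit (quotientKerPow (T - z • (1 : X →L[ℂ] X)) d)) :
    MeromorphicAt (resolvent T : ℂ → X →L[ℂ] X) z := by
  obtain ⟨d, hd⟩ := h
  obtain ⟨D, hSD, hDD, hd⟩ := exists_drazinInverse hd
  refine MeromorphicAt.congr ?_ ((eventually_resolvent_eq hSD hDD hd).mono fun μ hμ => hμ.2.symm)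
  have hinv : MeromorphicAt (fun μ : ℂ => (μ - z)⁻¹) z :=
    ((MeromorphicAt.id z).sub (MeromorphicAt.const z z)).inv
  have hprin : MeromorphicAt (fun μ : ℂ => ∑ k ∈ Finset.range d, ((μ - z)⁻¹) ^ (k + 1) •
      ((T - z • (1 : X →L[ℂ] X)) ^ k * (1 - (T - z • 1) * D))) z :=
    MeromorphicAt.fun_sum fun k _ => (hinv.pow (k + 1)).smul (MeromorphicAt.const _ z)
  have hreg : AnalyticAt ℂ (fun μ : ℂ => D * Ring.inverse (1 - (μ - z) • D)) z := by
    have h1 : AnalyticAt ℂ (fun μ : ℂ => (1 : X →L[ℂ] X) - (μ - z) • D) z := by fun_prop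
    have h2 : AnalyticAt ℂ (Ring.inverse : (X →L[ℂ] X) → X →L[ℂ] X)
        ((fun μ : ℂ => (1 : X →L[ℂ] X) - (μ - z) • D) z) := by
      simpa using analyticAt_inverse (𝕜 := ℂ) (1 : (X →L[ℂ] X)ˣ)
    exact analyticAt_const.mul (AnalyticAt.fun_comp h2 h1)
  simp only [Finset.sum_mul, smul_mul_assoc]
  exact hprin.sub hreg.meromorphicAt

omit [CompleteSpace X] in
/-- At a spectral point, a meromorphic resolvent has negative order. -/
theorem meromorphicOrderAt_resolvent_neg {T : X →L[ℂ] X} {z : ℂ} (hz : z ∈ spectrum ℂ T)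
    (hev : ∀ᶠ μ in 𝓝[≠] z, μ ∈ resolventSet ℂ T)
    (hm : MeromorphicAt (resolvent T : ℂ → X →L[ℂ] X) z) :
    meromorphicOrderAt (resolvent T : ℂ → X →L[ℂ] X) z < 0 := by
  by_contra! hneg
  -- Nonnegative order gives a limit `L`, and passing to the limit in the inverse identities makes
  -- `L` an inverse of `z - T`.
  obtain ⟨L, hL⟩ := (tendsto_nhds_iff_meromorphicOrderAt_nonneg hm).2 hneg
  have hA : Tendsto (fun μ : ℂ => algebraMap ℂ (X →L[ℂ] X) μ - T) (𝓝[≠] z)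
      (𝓝 (algebraMap ℂ (X →L[ℂ] X) z - T)) := by
    have : Continuous fun μ : ℂ => algebraMap ℂ (X →L[ℂ] X) μ - T :=
      (algebraMapCLM ℂ (X →L[ℂ] X)).continuous.sub continuous_const
    exact this.continuousAt.mono_left nhdsWithin_le_nhds
  have h1 : (algebraMap ℂ (X →L[ℂ] X) z - T) * L = 1 :=
    tendsto_nhds_unique ((hA.mul hL).congr' (hev.mono fun μ hμ => Ring.mul_inverse_cancel _ hμ))
      tendsto_const_nhds
  have h2 : L * (algebraMap ℂ (X →L[ℂ] X) z - T) = 1 :=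
    tendsto_nhds_unique ((hL.mul hA).congr' (hev.mono fun μ hμ => Ring.inverse_mul_cancel _ hμ))
      tendsto_const_nhds
  exact hz ⟨Units.mk _ _ h1 h2, rfl⟩

theorem isResolventPole {T : X →L[ℂ] X} {z : ℂ} (hz : z ∈ spectrum ℂ T)
    (h : ∃ d, IsUnit (quotientKerPow (T - z • (1 : X →L[ℂ] X)) d)) : IsResolventPole T z :=
  ⟨hz, eventually_mem_resolventSet h, meromorphicAt_resolvent h,
    meromorphicOrderAt_resolvent_neg hz (eventually_mem_resolventSet h)
      (meromorphicAt_resolvent h)⟩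

/-! ### Propagation along `Γ` by connectedness. -/

omit [CompleteSpace X] in
theorem frequently_isUnit_sub_of_mem_closure {T : X →L[ℂ] X} {z : ℂ}
    (hz : z ∈ closure (resolventSet ℂ T)) :
    ∃ᶠ μ in 𝓝 (0 : ℂ), IsUnit (T - z • (1 : X →L[ℂ] X) - μ • (1 : X →L[ℂ] X)) := by
  have h1 : ∃ᶠ μ in 𝓝 z, μ ∈ resolventSet ℂ T := mem_closure_iff_frequently.1 hz
  have h2 : Tendsto (fun μ : ℂ => μ - z) (𝓝 z) (𝓝 0) := by
    have : Continuous fun μ : ℂ => μ - z := by fun_prop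
    simpa using this.tendsto z
  refine h2.frequently (h1.mono fun μ hμ => ?_)
  have h3 : IsUnit (-(algebraMap ℂ (X →L[ℂ] X) μ - T)) := IsUnit.neg hμ
  convert h3 using 1
  rw [Algebra.algebraMap_eq_smul_one, sub_smul]
  abel

theorem isOpen_setOf_eventually_mem_resolventSet (T : X →L[ℂ] X) :
    IsOpen {z : ℂ | ∀ᶠ μ in 𝓝[≠] z, μ ∈ resolventSet ℂ T} := by
  rw [isOpen_iff_mem_nhds]
  intro z hz
  have hz : ∀ᶠ μ in 𝓝 z, μ ≠ z → μ ∈ resolventSet ℂ T := eventually_nhdsWithin_iff.1 hz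
  filter_upwards [hz] with μ hμ
  rcases eq_or_ne μ z with rfl | hne
  · exact eventually_nhdsWithin_iff.2 hz
  · exact mem_nhdsWithin_of_mem_nhds ((spectrum.isOpen_resolventSet T).mem_nhds (hμ hne))

omit [CompleteSpace X] in
theorem setOf_eventually_mem_resolventSet_subset_closure (T : X →L[ℂ] X) :
    {z : ℂ | ∀ᶠ μ in 𝓝[≠] z, μ ∈ resolventSet ℂ T} ⊆ closure (resolventSet ℂ T) := by
  intro z hz
  rw [mem_closure_iff_frequently]
  have hz : ∀ᶠ μ in 𝓝[≠] z, μ ∈ resolventSet ℂ T := hz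
  exact hz.frequently.filter_mono nhdsWithin_le_nhds

end TUD

theorem mainTheorem8 {X : Type*} [NormedAddCommGroup X] [NormedSpace ℂ X] [CompleteSpace X]
    (T : X →L[ℂ] X) (Γ : Set ℂ) (hΓ : IsConnected Γ)
    (hTUD : ∀ z ∈ Γ, TUD.IsTopologicalUniformDescent (T - z • (1 : X →L[ℂ] X)))
    (hD : ∃ α ∈ Γ, TUD.IsDrazinInvertible (T - α • (1 : X →L[ℂ] X))) :
    (∀ z ∈ spectrum ℂ T ∩ Γ, TUD.IsResolventPole T z) ∧
      (spectrum ℂ T ∩ Γ).Countable ∧ IsDiscrete (spectrum ℂ T ∩ Γ) := by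
  have hclosure : ∀ z ∈ Γ, z ∈ closure (resolventSet ℂ T) →
      ∃ d, IsUnit (TUD.quotientKerPow (T - z • (1 : X →L[ℂ] X)) d) := fun z hz hz' =>
    (hTUD z hz).exists_isUnit_quotientKerPow (TUD.frequently_isUnit_sub_of_mem_closure hz')
  obtain ⟨α, hα, hDα⟩ := hD
  have hsub : Γ ⊆ {z : ℂ | ∀ᶠ μ in 𝓝[≠] z, μ ∈ resolventSet ℂ T} := by
    -- Drazin invertibility at `α` only starts the argument; uniform descent supplies relative
    -- closedness.
    refine hΓ.isPreconnected.subset_of_closure_inter_subset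
      (TUD.isOpen_setOf_eventually_mem_resolventSet T)
      ⟨α, hα, TUD.eventually_mem_resolventSet hDα.exists_isUnit_quotientKerPow⟩ ?_
    rintro z ⟨hz, hzΓ⟩
    exact TUD.eventually_mem_resolventSet (hclosure z hzΓ
      (closure_minimal (TUD.setOf_eventually_mem_resolventSet_subset_closure T) isClosed_closure hz))
  have hdisc : IsDiscrete (spectrum ℂ T ∩ Γ) := by
    refine .of_nhdsWithin fun z hz => ?_
    rw [Filter.le_pure_iff, mem_nhdsWithin_iff_eventually]
    filter_upwards [eventually_nhdsWithin_iff.1 (hsub hz.2)] with μ hμ hμΓ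
    by_contra hne
    exact hμΓ.1 (hμ hne)
  refine ⟨fun z hz => TUD.isResolventPole hz.1 (hclosure z hz.2
    (TUD.setOf_eventually_mem_resolventSet_subset_closure T (hsub hz.2))), ?_, hdisc⟩
  -- Every subset of `ℂ` is Lindelöf, and a discrete Lindelöf set is countable.
  exact (HereditarilyLindelofSpace.isLindelof _).countable_of_isDiscrete hdisc
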